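/- Let $a,b\in\mathbb C$ and let $\mathcal W(a,b)$ be the complex Lie algebra with basis $\{L_i,I_i\}_{i\in\mathbb Z}$ and brackets $$[L_i,L_j]=(i-j)L_{i+j},\qquad [L_i,I_j]=-(j+bi+a)I_{i+j},\qquad [I_i,I_j]=0 .$$ For $\delta\in\mathbb C$, a nontrivial transposed $\delta$-Poisson structure on a Lie algebra $\mathfrak L$ with nonzero bracket is a nonzero commutative associative bilinear product $\cdot$ on $\mathfrak L$ such that $x\cdot[y,z]=\delta\big([x\cdot y,z]+[y,x\cdot z]\big)$ for all $x,y,z\in\mathfrak L$. Below, $\{\mu_k\}_{k\in\mathbb Z}$ and $\{\nu_k\}_{k\in\mathbb Z}$ denote families of complex numbers with only finitely many nonzero members, and all products of basis elements that are not listed (and do not follow from commutativity) are zero. 1. Let $b\notin\{-1,1\}$. Then $\mathcal W(a,b)$ admits a nontrivial transposed $\frac1{1-b}$-Poisson structure. A bilinear product on $\mathcal W(a,b)$ is a nontrivial transposed $\delta$-Poisson structure if and only if $\delta=\frac1{1-b}$ and there is a nonzero family $\{\mu_k\}$ such that for all $i,j\in\mathbb Z$ $$L_i\cdot L_j=\sum_{k\in\mathbb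 Z}\mu_k I_{i+j+k}.$$ 2. Let $b=1$. Then $\mathcal W(a,1)$ admits a nontrivial transposed $1$-Poisson structure. If $\delta\neq0$ or $a\notin\mathbb Z$, then a bilinear product on $\mathcal W(a,1)$ is a nontrivial transposed $\delta$-Poisson structure if and only if $\delta=1$ and there is a nonzero family $\{\mu_k\}$ such that for all $i,j\in\mathbb Z$ $$L_i\cdot L_j=\sum_{k\in\mathbb Z}(i+j+k+a)\,\mu_k\, I_{i+j+k}.$$ 3. Let $b=-1$. Then $\mathcal W(a,-1)$ admits a nontrivial transposed $\frac12$-Poisson structure. A bilinear product on $\mathcal W(a,-1)$ is a nontrivial transposed $\delta$-Poisson structure if and only if $\delta=\frac12$ and there are families $\{\nu_k\},\{\mu_k\}$, not both zero, such that for all $i,j\in\mathbb Z$ $$L_i\cdot L_j=\sum_{k\in\mathbb Z}\nu_k L_{i+j+k}+\sum_{k\in\mathbb Z}\mu_k I_{i+j+k},\qquad L_i\cdot I_j=\sum_{k\in\mathbb Z}\nu_k I_{i+j+k}.$$ -/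

import Mathlib

noncomputable section

/-- The underlying vector space of `W(a,b)`: the complex vector space with basis
`{L_i, I_i}` indexed by two copies of `ℤ` (`Sum.inl i` for `L_i`, `Sum.inr i` for `I_i`). -/
def WAlg (_a _b : ℂ) : Type := (ℤ ⊕ ℤ) →₀ ℂ

namespace WAlg

variable {a b : ℂ}

instance : AddCommGroup (WAlg a b) := inferInstanceAs (AddCommGroup ((ℤ ⊕ ℤ) →₀ ℂ))

instance : Module ℂ (WAlg a b) := inferInstanceAs (Module ℂ ((ℤ ⊕ ℤ) →₀ ℂ))

/-- The basis `{L_i, I_i}` of `W(a,b)`. -/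
def basis (a b : ℂ) : Module.Basis (ℤ ⊕ ℤ) ℂ (WAlg a b) :=
  Module.Basis.ofRepr (LinearEquiv.refl ℂ ((ℤ ⊕ ℤ) →₀ ℂ))

/-- The basis element `L_i`. -/
def L (a b : ℂ) (i : ℤ) : WAlg a b := basis a b (Sum.inl i)

/-- The basis element `I_i`. -/
def I (a b : ℂ) (i : ℤ) : WAlg a b := basis a b (Sum.inr i)

/-- The multiplication table of `W(a,b)`. -/
def table (a b : ℂ) : ℤ ⊕ ℤ → ℤ ⊕ ℤ → WAlg a b
  | Sum.inl i, Sum.inl j => ((i : ℂ) - j) • L a b (i + j)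
  | Sum.inl i, Sum.inr j => (-((j : ℂ) + b * i + a)) • I a b (i + j)
  | Sum.inr i, Sum.inl j => ((i : ℂ) + b * j + a) • I a b (i + j)
  | Sum.inr _, Sum.inr _ => 0

/-- The bilinear extension of the multiplication table. -/
def bracket (a b : ℂ) : WAlg a b →ₗ[ℂ] WAlg a b →ₗ[ℂ] WAlg a b :=
  (basis a b).constr ℂ fun s => (basis a b).constr ℂ (table a b s)

theorem bracket_basis (s t : ℤ ⊕ ℤ) :
    bracket a b (basis a b s) (basis a b t) = table a b s t := by
  simp [bracket, Module.Basis.constr_basis]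

theorem bracket_L_L (i j : ℤ) :
    bracket a b (L a b i) (L a b j) = ((i : ℂ) - j) • L a b (i + j) :=
  bracket_basis _ _

theorem bracket_L_I (i j : ℤ) :
    bracket a b (L a b i) (I a b j) = (-((j : ℂ) + b * i + a)) • I a b (i + j) :=
  bracket_basis _ _

theorem bracket_I_L (i j : ℤ) :
    bracket a b (I a b i) (L a b j) = ((i : ℂ) + b * j + a) • I a b (i + j) :=
  bracket_basis _ _

theorem bracket_I_I (i j : ℤ) : bracket a b (I a b i) (I a b j) = 0 :=
  bracket_basis _ _

theorem bracket_skew (x y : WAlg a b) : bracket a b x y = -bracket a b y x := by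
  have h : bracket a b = -(bracket a b).flip := by
    refine (basis a b).ext fun s => (basis a b).ext fun t => ?_
    simp only [LinearMap.neg_apply, LinearMap.flip_apply, bracket_basis]
    rcases s with i | i <;> rcases t with j | j <;> simp only [table, add_comm j i] <;> module
  exact LinearMap.congr_fun₂ h x y

theorem bracket_self (x : WAlg a b) : bracket a b x x = 0 := by
  have h := bracket_skew x x
  have h2 : (2 : ℂ) • bracket a b x x = 0 := by
    rw [two_smul]
    exact eq_neg_iff_add_eq_zero.mp h
  exact (smul_eq_zero.mp h2).resolve_left two_ne_zero

theorem bracket_leibniz (x y z : WAlg a b) :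
    bracket a b x (bracket a b y z) =
      bracket a b (bracket a b x y) z + bracket a b y (bracket a b x z) := by
  have key : ∀ s t u : ℤ ⊕ ℤ,
      bracket a b (basis a b s) (bracket a b (basis a b t) (basis a b u)) =
        bracket a b (bracket a b (basis a b s) (basis a b t)) (basis a b u) +
          bracket a b (basis a b t) (bracket a b (basis a b s) (basis a b u)) := by
    intro s t u
    simp only [bracket_basis]
    rcases s with i | i <;> rcases t with j | j <;> rcases u with k | k <;>
      simp only [table, map_smul, map_zero, LinearMap.smul_apply, LinearMap.zero_apply, L, I,
        bracket_basis, smul_zero, add_zero, add_assoc, add_left_comm j i k, Int.cast_add] <;>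
      module
  have key₁ : ∀ (t u : ℤ ⊕ ℤ) (x : WAlg a b),
      bracket a b x (bracket a b (basis a b t) (basis a b u)) =
        bracket a b (bracket a b x (basis a b t)) (basis a b u) +
          bracket a b (basis a b t) (bracket a b x (basis a b u)) := fun t u x =>
    LinearMap.congr_fun
      (f := (bracket a b).flip (bracket a b (basis a b t) (basis a b u)))
      (g := (bracket a b).flip (basis a b u) ∘ₗ (bracket a b).flip (basis a b t) +
        bracket a b (basis a b t) ∘ₗ (bracket a b).flip (basis a b u))
      ((basis a b).ext fun s => key s t u) x
  have key₂ : ∀ (u : ℤ ⊕ ℤ) (x y : WAlg a b),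
      bracket a b x (bracket a b y (basis a b u)) =
        bracket a b (bracket a b x y) (basis a b u) +
          bracket a b y (bracket a b x (basis a b u)) := fun u x y =>
    LinearMap.congr_fun
      (f := bracket a b x ∘ₗ (bracket a b).flip (basis a b u))
      (g := (bracket a b).flip (basis a b u) ∘ₗ bracket a b x +
        (bracket a b).flip (bracket a b x (basis a b u)))
      ((basis a b).ext fun t => key₁ t u x) y
  exact LinearMap.congr_fun
    (f := bracket a b x ∘ₗ bracket a b y)
    (g := bracket a b (bracket a b x y) + bracket a b y ∘ₗ bracket a b x)
    ((basis a b).ext fun u => key₂ u x y) z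

/-- `W(a,b)` is a Lie algebra. -/
instance : LieRing (WAlg a b) where
  bracket x y := bracket a b x y
  add_lie x y z := by simp
  lie_add x y z := by simp
  lie_self x := bracket_self x
  leibniz_lie x y z := bracket_leibniz x y z

instance : LieAlgebra ℂ (WAlg a b) where
  lie_smul c x y := by simp [Bracket.bracket]

theorem lie_L_L (i j : ℤ) : ⁅L a b i, L a b j⁆ = ((i : ℂ) - j) • L a b (i + j) :=
  bracket_L_L i j

theorem lie_L_I (i j : ℤ) :
    ⁅L a b i, I a b j⁆ = (-((j : ℂ) + b * i + a)) • I a b (i + j) :=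
  bracket_L_I i j

theorem lie_I_I (i j : ℤ) : ⁅I a b i, I a b j⁆ = 0 :=
  bracket_I_I i j

end WAlg

/-- `mul` makes the complex Lie algebra `P` a transposed `δ`-Poisson algebra. -/
structure IsTransposedPoisson {P : Type*} [LieRing P] [LieAlgebra ℂ P] (δ : ℂ)
    (mul : P →ₗ[ℂ] P →ₗ[ℂ] P) : Prop where
  comm : ∀ x y, mul x y = mul y x
  assoc : ∀ x y z, mul (mul x y) z = mul x (mul y z)
  transposed : ∀ x y z, mul x ⁅y, z⁆ = δ • (⁅mul x y, z⁆ + ⁅y, mul x z⁆)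

/-- `mul` is a nontrivial transposed `δ`-Poisson structure on the complex Lie algebra `P`:
a transposed `δ`-Poisson structure for which both multiplications are nonzero. -/
structure IsNontrivialTransposedPoisson {P : Type*} [LieRing P] [LieAlgebra ℂ P] (δ : ℂ)
    (mul : P →ₗ[ℂ] P →ₗ[ℂ] P) : Prop extends IsTransposedPoisson δ mul where
  mul_ne_zero : ∃ x y, mul x y ≠ 0
  lie_ne_zero : ∃ x y : P, ⁅x, y⁆ ≠ 0

end

/-! For fixed `x`, multiplication by `x` is a `δ`-derivation: `φ[y,z] = δ([φy,z] + [y,φz])`. Reading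
this in coordinates and separating by degree shift `m` turns every condition on the product into a
functional equation for scalar functions on `ℤ`.

Two facts drive the classification. First, the cyclic identity `x·[y,z] + y·[z,x] + z·[x,y] = 0`
makes `L_i·L_j` depend only on `i + j` (`mul_L_L`), so the transposed law on the `L`'s has three
free integer parameters. Its solutions are affine in the index: the `L`-coefficients are constant
and vanish unless `δ = 1/2` (`witt_coeff_const`). The `I`-coefficients are constant, with `δ(1 - b)
= 1` if nonzero, except that a nonzero slope is possible for `b = δ = 1` and then gives the weight
`N + a` of `I_N` (`tensor_coeff_affine`).

Second, for `δ ≠ 0` a `δ`-derivation maps the ideal of the `I`'s into itself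
(`outer_coeff_eq_zero`), and its action there is rigid (`inner_coeff_eq_zero`). Hence `I·I = 0`, and
`L·I = 0` unless `b = -1` and `δ = 1/2`, where `L·I` copies the `L`-coefficients of `L·L`. Those
coefficients vanish for `b ≠ -1` by `scalar_action_eq_zero`. The converse is a coefficient check,
done once for a general weight `w`. -/

noncomputable section

/-! ### Scalar functional equations -/

/-- A solution of the functional equation for the `L`-coefficients of `L_i · L_j` is constant. -/
theorem witt_coeff_const {δ : ℂ} {m : ℤ} {α : ℤ → ℂ}
    (h : ∀ p q s : ℤ, ((p : ℂ) - q) * α (p + q + s) =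
      δ * (((p : ℂ) + m - q - s) * α p - ((q : ℂ) + m - p - s) * α q)) :
    (∀ n, α n = α 0) ∧ (1 - 2 * δ) * α 0 = 0 := by
  -- With `p = 1`, `q = 0` the right side is affine in `s`, while the left side is `α (1 + s)`; the
  -- choices `s = -1, 0` supply the values at `0` and `1`.
  have haff : ∀ n : ℤ, α n = α 0 + (α 1 - α 0) * n := by
    intro n
    have hn := h 1 0 (n - 1)
    have h0 := h 1 0 (-1)
    have h1 := h 1 0 0
    rw [show (1 : ℤ) + 0 + (n - 1) = n by ring] at hn
    norm_num at hn h0 h1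
    linear_combination hn - (1 - n) * h0 - n * h1
  have e1 := h 1 0 0
  have e2 := h 1 0 1
  have e3 := h 2 1 0
  norm_num at e1 e2 e3
  have h2 := haff 2
  have h3 := haff 3
  norm_num at h2 h3
  rw [h2] at e2 e3
  rw [h3] at e3
  -- For the slope `v`, comparing `e2` with `e1` gives `v = -δ v`, and comparing `e3` with `e1`
  -- gives `v = δ v`.
  have hv : α 1 - α 0 = 0 := by
    linear_combination (e2 - e1) / 2 + (e3 - e1) / 4
  refine ⟨fun n => by rw [haff n, hv]; ring, ?_⟩
  linear_combination e1 + (-1 + δ * (1 + m + 1)) * hv - δ * hv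

/-- A solution of the functional equation for the `I`-coefficients of `L_i · L_j` is affine. -/
theorem tensor_coeff_affine {a b δ : ℂ} {m : ℤ} {β : ℤ → ℂ}
    (h : ∀ p q s : ℤ, ((p : ℂ) - q) * β (p + q + s) =
      δ * (((p : ℂ) + m + b * (q + s) + a) * β p - ((q : ℂ) + m + b * (p + s) + a) * β q)) :
    (∀ n : ℤ, β n = β 0 + (β 1 - β 0) * n) ∧ (1 - δ) * (β 1 - β 0) = 0 ∧
      (1 - δ * b) * (β 1 - β 0) = 0 ∧
      β 0 = δ * ((1 - b) * β 0 + (m + a) * (β 1 - β 0)) := by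
  have haff : ∀ n : ℤ, β n = β 0 + (β 1 - β 0) * n := by
    intro n
    have hn := h 1 0 (n - 1)
    have h0 := h 1 0 (-1)
    have h1 := h 1 0 0
    rw [show (1 : ℤ) + 0 + (n - 1) = n by ring] at hn
    norm_num at hn h0 h1
    linear_combination hn - (1 - n) * h0 - n * h1
  have e0 := h 1 0 (-1)
  have e1 := h 1 0 0
  have e3 := h 2 1 0
  norm_num at e0 e1 e3
  have h2 := haff 2
  have h3 := haff 3
  norm_num at h2 h3
  rw [h2, h3] at e3
  have hv : (1 - δ) * (β 1 - β 0) = 0 := by linear_combination (e3 - e1) / 2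
  have hv' : (1 - δ * b) * (β 1 - β 0) = 0 := by linear_combination e1 - e0
  exact ⟨haff, hv, hv', by linear_combination e1 - hv⟩

/-- Shifting out of `n` by 1 and by 2 would force `b = 0`, whereas shifting into `n` by 1 and by 2
would force `b = 1`. -/
theorem inner_coeff_single_support {a b δ : ℂ} {m : ℤ} {D : ℤ → ℂ} (hδ : δ ≠ 0)
    (h : ∀ i j : ℤ, ((j : ℂ) + b * i + a) * D (i + j) = δ * (((j : ℂ) + m + b * i + a) * D j))
    {n : ℤ} (hn : ∀ k, k ≠ n → D k = 0) : D n = 0 := by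
  by_contra hD
  have e1 := h 1 n
  have e2 := h 2 n
  have e3 := h 1 (n - 1)
  have e4 := h 2 (n - 2)
  rw [hn _ (by omega)] at e1 e2
  rw [hn (n - 1) (by omega), show 1 + (n - 1) = n by ring] at e3
  rw [hn (n - 2) (by omega), show 2 + (n - 2) = n by ring] at e4
  simp only [mul_zero, zero_eq_mul, mul_eq_zero, hδ, hD, or_false, false_or] at e1 e2 e3 e4
  push_cast at e1 e2 e3 e4
  have : (1 : ℂ) = 0 := by linear_combination e3 - e4 + e2 - e1
  exact one_ne_zero this

/-- At `i = 0`, each index `j` with `D j ≠ 0` satisfies `j + a = δ (j + m + a)`. Two such indices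
force `δ = 1` and then `m = 0`, so the support has at most one point. The case `δ = 1`, `m = 0` is a
true exception, since constant `D` solves the equation. -/
theorem inner_coeff_eq_zero {a b δ : ℂ} {m : ℤ} {D : ℤ → ℂ} (hδ : δ ≠ 0)
    (hm : δ = 1 → m ≠ 0)
    (h : ∀ i j : ℤ, ((j : ℂ) + b * i + a) * D (i + j) = δ * (((j : ℂ) + m + b * i + a) * D j))
    (n : ℤ) : D n = 0 := by
  by_contra hD
  refine hD (inner_coeff_single_support hδ h fun k hk => ?_)
  by_contra hDk
  have e1 := h 0 n
  have e2 := h 0 k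
  rw [zero_add] at e1 e2
  push_cast at e1 e2
  have e1' := mul_right_cancel₀ hD (e1.trans (mul_assoc _ _ _).symm)
  have e2' := mul_right_cancel₀ hDk (e2.trans (mul_assoc _ _ _).symm)
  have h3 : ((k : ℂ) - n) * (1 - δ) = 0 := by linear_combination e2' - e1'
  rcases mul_eq_zero.mp h3 with h3 | h3
  · exact hk (by exact_mod_cast sub_eq_zero.mp h3)
  · obtain rfl : δ = 1 := (sub_eq_zero.mp h3).symm
    apply hm rfl
    have : (m : ℂ) = 0 := by linear_combination -e1'
    exact_mod_cast this

/-- Again `j = 0` yields a linear equation on the support. For `δ ≠ 1` it has at most one root, and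
`h₂` against two neighbours kills that value. For `δ = 1` it only says `a = m`, and both equations
are needed to force first `b = 0` and then `c = 0`. -/
theorem outer_coeff_eq_zero {a b δ : ℂ} {m : ℤ} {c : ℤ → ℂ}
    (h₁ : ∀ j k : ℤ, -((k : ℂ) + b * j + a) * c (j + k) = δ * (((j : ℂ) - k - m) * c k))
    (h₂ : ∀ j k : ℤ, ((k : ℂ) + b * (j + m) + a) * c j = ((j : ℂ) + b * (k + m) + a) * c k)
    (n : ℤ) : c n = 0 := by
  by_contra hn
  have key : ∀ k, c k ≠ 0 → (k : ℂ) + a = δ * (k + m) := by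
    intro k hk
    have e := h₁ 0 k
    rw [zero_add] at e
    push_cast at e
    refine mul_right_cancel₀ hk ?_
    linear_combination -e
  by_cases hδ : δ = 1
  · subst hδ
    have ha : a = m := by linear_combination key n hn
    subst ha
    have h0 : c (-m) = 0 := by
      have e1 := h₁ 1 (-m)
      have e2 := h₂ (-m) (1 + -m)
      push_cast at e1 e2
      linear_combination (e2 - e1) / 2
    have hb : ∀ k : ℤ, k ≠ 0 → b * c (k - m) = 0 := by
      intro k hk
      have e1 := h₁ k (-m)
      rw [h0, show k + -m = k - m by ring] at e1
      push_cast at e1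
      have hk' : (k : ℂ) ≠ 0 := by exact_mod_cast hk
      refine (mul_eq_zero.mp (?_ : (k : ℂ) * (b * c (k - m)) = 0)).resolve_left hk'
      linear_combination -e1
    have hnm : n + m ≠ 0 := by
      intro h
      rw [show n = -m by omega] at hn
      exact hn h0
    have hb0 : b = 0 := by
      have := hb (n + m) hnm
      rw [show n + m - m = n by ring] at this
      exact (mul_eq_zero.mp this).resolve_right hn
    subst hb0
    -- The choice `j = n + m` makes the factor `j - n - m` on the right of `h₁` vanish.
    have e1 := h₁ (n + m) n
    have e2 := h₂ (n + m + n) n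
    have hnm' : (n : ℂ) + m ≠ 0 := by exact_mod_cast hnm
    push_cast at e1 e2
    refine hn ((mul_eq_zero.mp (?_ : ((n : ℂ) + m) * c n = 0)).resolve_left hnm')
    linear_combination (-e1 - e2) / 2
  · have hz : ∀ k, k ≠ n → c k = 0 := by
      intro k hk
      by_contra hck
      have h3 : ((k : ℂ) - n) * (1 - δ) = 0 := by linear_combination key k hck - key n hn
      rcases mul_eq_zero.mp h3 with h3 | h3
      · exact hk (by exact_mod_cast sub_eq_zero.mp h3)
      · exact hδ (sub_eq_zero.mp h3).symm
    have e1 := h₂ n (n + 1)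
    have e2 := h₂ n (n + 2)
    rw [hz (n + 1) (by omega)] at e1
    rw [hz (n + 2) (by omega)] at e2
    push_cast at e1 e2
    exact hn (by linear_combination e2 - e1)

/-- A nonzero scalar action on the Witt part extends to the tensor densities only if `b = -1`. -/
theorem scalar_action_eq_zero {a b u : ℂ} (hb : b ≠ -1) {D : ℤ → ℤ → ℂ}
    (h : ∀ m i j : ℤ, ((j : ℂ) + b * i + a) * D m (i + j) =
      1 / 2 * (((j : ℂ) + b * (i + m) + a) * u + ((j : ℂ) + m + b * i + a) * D m j)) : u = 0 := by
  have h0 : ∀ m j : ℤ, ((j : ℂ) + a - m) * D m j = ((j : ℂ) + b * m + a) * u := by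
    intro m j
    have e := h m 0 j
    rw [zero_add] at e
    push_cast at e
    linear_combination 2 * e
  -- Eliminating `D` with `h0`, by clearing the factors `j + a - m` and `i + j + a - m`, leaves a
  -- polynomial condition on `u` alone.
  have key : ∀ m i j : ℤ,
      (i : ℂ) * m * (1 + b) * ((b - 2) * (j + a) - b * (i + m)) * u = 0 := by
    intro m i j
    have e1 := h0 m (i + j)
    have e2 := h0 m j
    have e := h m i j
    push_cast at e1
    linear_combination (2 * ((j : ℂ) + a + i - m) * (j + a - m)) * e
      - 2 * ((j : ℂ) + b * i + a) * (j + a - m) * e1 + ((j : ℂ) + m + b * i + a) * (j + a + i - m) * e2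
  have k1 := key 1 1 0
  have k2 := key 2 1 0
  have k3 := key 1 1 1
  push_cast at k1 k2 k3
  have hb' : 1 + b ≠ 0 := fun h => hb (by linear_combination h)
  refine (mul_eq_zero.mp (?_ : (1 + b) * u = 0)).resolve_left hb'
  -- The two differences equal `(1 + b) b u` and `(1 + b)(b - 2) u`; subtracting them removes the
  -- unwanted factor.
  linear_combination (k1 - k2 / 2) / 2 - (k3 - k1) / 2

namespace WAlg

variable {a b : ℂ}

/-! ### Coordinates -/

/-- The coefficient of `L_n`. -/
def coordL (a b : ℂ) (n : ℤ) : WAlg a b →ₗ[ℂ] ℂ := (basis a b).coord (Sum.inl n)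

/-- The coefficient of `I_n`. -/
def coordI (a b : ℂ) (n : ℤ) : WAlg a b →ₗ[ℂ] ℂ := (basis a b).coord (Sum.inr n)

@[simp] theorem coordL_L (n i : ℤ) : coordL a b n (L a b i) = if i = n then 1 else 0 := by
  simp [coordL, L, Finsupp.single_apply]

@[simp] theorem coordL_I (n i : ℤ) : coordL a b n (I a b i) = 0 := by
  simp [coordL, I]

@[simp] theorem coordI_I (n i : ℤ) : coordI a b n (I a b i) = if i = n then 1 else 0 := by
  simp [coordI, I, Finsupp.single_apply]

@[simp] theorem coordI_L (n i : ℤ) : coordI a b n (L a b i) = 0 := by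
  simp [coordI, L]

theorem ext_coord {x y : WAlg a b} (hL : ∀ n, coordL a b n x = coordL a b n y)
    (hI : ∀ n, coordI a b n x = coordI a b n y) : x = y :=
  (basis a b).ext_elem fun s => s.casesOn hL hI

theorem linearMap_ext {V : Type*} [AddCommGroup V] [Module ℂ V] {f g : WAlg a b →ₗ[ℂ] V}
    (hL : ∀ i, f (L a b i) = g (L a b i)) (hI : ∀ i, f (I a b i) = g (I a b i)) : f = g :=
  (basis a b).ext fun s => s.casesOn hL hI

theorem lie_I_L (i j : ℤ) : ⁅I a b i, L a b j⁆ = ((i : ℂ) + b * j + a) • I a b (i + j) :=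
  bracket_I_L i j

/-- The bracket with a fixed second argument. -/
def lieRight (y : WAlg a b) : WAlg a b →ₗ[ℂ] WAlg a b := (bracket a b).flip y

theorem lieRight_apply (x y : WAlg a b) : lieRight y x = ⁅x, y⁆ := rfl

theorem coordL_lie_L (x : WAlg a b) (n j : ℤ) :
    coordL a b n ⁅x, L a b j⁆ = ((n : ℂ) - 2 * j) * coordL a b (n - j) x := by
  refine LinearMap.congr_fun (f := coordL a b n ∘ₗ lieRight (L a b j))
    (g := ((n : ℂ) - 2 * j) • coordL a b (n - j)) (linearMap_ext (fun i => ?_) fun i => ?_) x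
  · simp only [LinearMap.comp_apply, lieRight_apply, lie_L_L, map_smul, coordL_L,
      LinearMap.smul_apply, smul_eq_mul, eq_sub_iff_add_eq]
    split_ifs with h
    · subst h; push_cast; ring
    · ring
  · simp [lieRight_apply, lie_I_L]

theorem coordI_lie_L (x : WAlg a b) (n j : ℤ) :
    coordI a b n ⁅x, L a b j⁆ = ((n : ℂ) - j + b * j + a) * coordI a b (n - j) x := by
  refine LinearMap.congr_fun (f := coordI a b n ∘ₗ lieRight (L a b j))
    (g := ((n : ℂ) - j + b * j + a) • coordI a b (n - j))
    (linearMap_ext (fun i => ?_) fun i => ?_) x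
  · simp [lieRight_apply, lie_L_L]
  · simp only [LinearMap.comp_apply, lieRight_apply, lie_I_L, map_smul, coordI_I,
      LinearMap.smul_apply, smul_eq_mul, eq_sub_iff_add_eq]
    split_ifs with h
    · subst h; push_cast; ring
    · ring

theorem coordL_lie_I (x : WAlg a b) (n j : ℤ) : coordL a b n ⁅x, I a b j⁆ = 0 := by
  refine LinearMap.congr_fun (f := coordL a b n ∘ₗ lieRight (I a b j))
    (g := 0) (linearMap_ext (fun i => ?_) fun i => ?_) x
  · simp [lieRight_apply, lie_L_I]
  · simp [lieRight_apply, lie_I_I]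

theorem coordI_lie_I (x : WAlg a b) (n j : ℤ) :
    coordI a b n ⁅x, I a b j⁆ = -((j : ℂ) + b * (n - j) + a) * coordL a b (n - j) x := by
  refine LinearMap.congr_fun (f := coordI a b n ∘ₗ lieRight (I a b j))
    (g := (-((j : ℂ) + b * (n - j) + a)) • coordL a b (n - j))
    (linearMap_ext (fun i => ?_) fun i => ?_) x
  · simp only [LinearMap.comp_apply, lieRight_apply, lie_L_I, map_smul, coordI_I, coordL_L,
      LinearMap.smul_apply, smul_eq_mul, eq_sub_iff_add_eq]
    split_ifs with h
    · subst h; push_cast; ring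
    · ring
  · simp [lieRight_apply, lie_I_I]

theorem coordL_L_lie (x : WAlg a b) (n j : ℤ) :
    coordL a b n ⁅L a b j, x⁆ = -(((n : ℂ) - 2 * j) * coordL a b (n - j) x) := by
  rw [← lie_skew, map_neg, coordL_lie_L]

theorem coordI_L_lie (x : WAlg a b) (n j : ℤ) :
    coordI a b n ⁅L a b j, x⁆ = -(((n : ℂ) - j + b * j + a) * coordI a b (n - j) x) := by
  rw [← lie_skew, map_neg, coordI_lie_L]

theorem coordI_I_lie (x : WAlg a b) (n j : ℤ) :
    coordI a b n ⁅I a b j, x⁆ = ((j : ℂ) + b * (n - j) + a) * coordL a b (n - j) x := by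
  rw [← lie_skew, map_neg, coordI_lie_I]; ring

/-! ### `δ`-derivations -/

section Derivation

variable {δ : ℂ} {φ : WAlg a b →ₗ[ℂ] WAlg a b}

/-- In degree shift `n - k`, brackets `[L, I]` give the first hypothesis of `outer_coeff_eq_zero`;
the relation `[I, I] = 0` gives the second once `δ` is cancelled. -/
theorem coordL_map_I (hδ : δ ≠ 0) (h : ∀ y z, φ ⁅y, z⁆ = δ • (⁅φ y, z⁆ + ⁅y, φ z⁆)) (n k : ℤ) :
    coordL a b n (φ (I a b k)) = 0 := by
  have := outer_coeff_eq_zero (a := a) (b := b) (δ := δ) (m := n - k)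
    (c := fun k' => coordL a b (k' + (n - k)) (φ (I a b k'))) (fun i j => ?_) (fun i j => ?_) k
  · simpa using this
  · have e := congrArg (coordL a b (i + j + (n - k))) (h (L a b i) (I a b j))
    rw [lie_L_I] at e
    simp only [map_smul, map_add, coordL_lie_I, coordL_L_lie, smul_eq_mul] at e
    rw [show i + j + (n - k) - i = j + (n - k) by ring] at e
    push_cast at e ⊢
    linear_combination e
  · have e := congrArg (coordI a b (i + j + (n - k))) (h (I a b i) (I a b j))
    rw [lie_I_I] at e
    simp only [map_smul, map_add, map_zero, coordI_lie_I, coordI_I_lie, smul_eq_mul,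
      zero_eq_mul, hδ, false_or] at e
    rw [show i + j + (n - k) - i = j + (n - k) by ring,
      show i + j + (n - k) - j = i + (n - k) by ring] at e
    push_cast at e ⊢
    linear_combination -e

theorem coordI_map_I_eq (h : ∀ y z, φ ⁅y, z⁆ = δ • (⁅φ y, z⁆ + ⁅y, φ z⁆)) (m i j : ℤ) :
    ((j : ℂ) + b * i + a) * coordI a b (i + j + m) (φ (I a b (i + j))) =
      δ * (((j : ℂ) + b * (i + m) + a) * coordL a b (i + m) (φ (L a b i)) +
        ((j : ℂ) + m + b * i + a) * coordI a b (j + m) (φ (I a b j))) := by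
  have e := congrArg (coordI a b (i + j + m)) (h (L a b i) (I a b j))
  rw [lie_L_I] at e
  simp only [map_smul, map_add, coordI_lie_I, coordI_L_lie, smul_eq_mul] at e
  rw [show i + j + m - i = j + m by ring, show i + j + m - j = i + m by ring] at e
  push_cast at e ⊢
  linear_combination -e

theorem coordI_map_I_eq_zero (hδ : δ ≠ 0) (h : ∀ y z, φ ⁅y, z⁆ = δ • (⁅φ y, z⁆ + ⁅y, φ z⁆))
    (hL : ∀ i n, coordL a b n (φ (L a b i)) = 0) {n k : ℤ} (hn : δ = 1 → n ≠ k) :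
    coordI a b n (φ (I a b k)) = 0 := by
  have := inner_coeff_eq_zero (a := a) (b := b) (m := n - k)
    (D := fun k' => coordI a b (k' + (n - k)) (φ (I a b k'))) hδ
    (fun h1 => sub_ne_zero.mpr (hn h1)) (fun i j => ?_) k
  · simpa using this
  · have := coordI_map_I_eq h (n - k) i j
    rw [hL, mul_zero, zero_add] at this
    exact this

end Derivation

end WAlg

namespace WAlg

variable {a b : ℂ}

theorem bilin_ext {f g : WAlg a b →ₗ[ℂ] WAlg a b →ₗ[ℂ] WAlg a b}
    (hLL : ∀ i j, f (L a b i) (L a b j) = g (L a b i) (L a b j))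
    (hLI : ∀ i j, f (L a b i) (I a b j) = g (L a b i) (I a b j))
    (hIL : ∀ i j, f (I a b i) (L a b j) = g (I a b i) (L a b j))
    (hII : ∀ i j, f (I a b i) (I a b j) = g (I a b i) (I a b j)) : f = g :=
  linearMap_ext (fun i => linearMap_ext (hLL i) (hLI i))
    fun i => linearMap_ext (hIL i) (hII i)

/-! ### The structure of a transposed `δ`-Poisson product -/

section Product

variable {δ : ℂ} {mul : WAlg a b →ₗ[ℂ] WAlg a b →ₗ[ℂ] WAlg a b}

/-- Commutativity makes the six brackets on the right sides cancel in pairs, so `δ` disappears. -/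
theorem mul_lie_cyclic (h : IsTransposedPoisson δ mul) (x y z : WAlg a b) :
    mul x ⁅y, z⁆ + mul y ⁅z, x⁆ + mul z ⁅x, y⁆ = 0 := by
  rw [h.transposed, h.transposed, h.transposed, h.comm y x, h.comm z x, h.comm z y,
    ← lie_skew (mul x z) y, ← lie_skew (mul y z) x, ← lie_skew (mul x y) z]
  module

/-- For distinct indices the cyclic identity on `L_p, L_q, L_0` is `(q - p)` times the claim. Equal
indices are reached through a triple whose other products have distinct indices. -/
theorem mul_L_L (h : IsTransposedPoisson δ mul) (i j : ℤ) :
    mul (L a b i) (L a b j) = mul (L a b 0) (L a b (i + j)) := by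
  have hne : ∀ p q : ℤ, p ≠ q →
      mul (L a b p) (L a b q) = mul (L a b 0) (L a b (p + q)) := by
    intro p q hpq
    have e := mul_lie_cyclic h (L a b p) (L a b q) (L a b 0)
    simp only [lie_L_L, map_smul, add_zero, zero_add] at e
    rw [h.comm (L a b q) (L a b p)] at e
    have hpq' : (q : ℂ) - p ≠ 0 := sub_ne_zero.mpr (by exact_mod_cast hpq.symm)
    rw [← sub_eq_zero]
    refine (smul_eq_zero.mp (?_ : ((q : ℂ) - p) • (_ : WAlg a b) = 0)).resolve_left hpq'
    rw [← e]
    push_cast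
    module
  rcases eq_or_ne i j with rfl | hij
  -- Any `q > |i|` ensures `q ≠ 0`, `q ≠ i` and `i ≠ 2q`, which is all that is used.
  · obtain ⟨q, hq⟩ : ∃ q : ℤ, q = i.natAbs + 1 := ⟨_, rfl⟩
    have e := mul_lie_cyclic h (L a b i) (L a b (i - q)) (L a b q)
    simp only [lie_L_L, map_smul] at e
    rw [hne (i - q) (q + i) (by omega), hne q (i + (i - q)) (by omega),
      show i - q + (q + i) = i + i by ring, show q + (i + (i - q)) = i + i by ring,
      show i - q + q = i by ring] at e
    have hq' : (i : ℂ) - q - q ≠ 0 := by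
      have : i - q - q ≠ 0 := by omega
      exact_mod_cast this
    rw [← sub_eq_zero]
    refine (smul_eq_zero.mp (?_ : ((i : ℂ) - q - q) • (_ : WAlg a b) = 0)).resolve_left hq'
    rw [← e]
    push_cast
    module
  · exact hne i j hij

/-- Multiplying by `L_{-s}` rather than by `L_0` costs nothing, by `mul_L_L`, and introduces the
free parameter `s`. -/
theorem mul_L_L_shift (h : IsTransposedPoisson δ mul) (p q s : ℤ) :
    ((p : ℂ) - q) • mul (L a b 0) (L a b (p + q + s)) =
      δ • (⁅mul (L a b 0) (L a b p), L a b (q + s)⁆ +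
        ⁅L a b (p + s), mul (L a b 0) (L a b q)⁆) := by
  have e := h.transposed (L a b (-s)) (L a b (p + s)) (L a b (q + s))
  rw [lie_L_L, map_smul, mul_L_L h, mul_L_L h _ (p + s), mul_L_L h _ (q + s),
    show -s + (p + s + (q + s)) = p + q + s by ring, show -s + (p + s) = p by ring,
    show -s + (q + s) = q by ring] at e
  rw [← e]
  push_cast
  module

theorem coordL_mul_L_L (h : IsTransposedPoisson δ mul) (m : ℤ) :
    (∀ p, coordL a b (p + m) (mul (L a b 0) (L a b p)) =
      coordL a b m (mul (L a b 0) (L a b 0))) ∧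
    (1 - 2 * δ) * coordL a b m (mul (L a b 0) (L a b 0)) = 0 := by
  have := witt_coeff_const (δ := δ) (m := m)
    (α := fun p => coordL a b (p + m) (mul (L a b 0) (L a b p))) (fun p q s => ?_)
  · simpa using this
  · have e := congrArg (coordL a b (p + q + s + m)) (mul_L_L_shift h p q s)
    simp only [map_smul, map_add, smul_eq_mul, coordL_lie_L, coordL_L_lie] at e
    rw [show p + q + s + m - (q + s) = p + m by ring,
      show p + q + s + m - (p + s) = q + m by ring] at e
    rw [e]
    push_cast
    ring

theorem coordI_mul_L_L (h : IsTransposedPoisson δ mul) (m : ℤ) :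
    ∃ v : ℂ, v = coordI a b (1 + m) (mul (L a b 0) (L a b 1)) -
        coordI a b m (mul (L a b 0) (L a b 0)) ∧
      (∀ p : ℤ, coordI a b (p + m) (mul (L a b 0) (L a b p)) =
        coordI a b m (mul (L a b 0) (L a b 0)) + v * p) ∧
      (1 - δ) * v = 0 ∧ (1 - δ * b) * v = 0 ∧
      coordI a b m (mul (L a b 0) (L a b 0)) =
        δ * ((1 - b) * coordI a b m (mul (L a b 0) (L a b 0)) + (m + a) * v) := by
  have := tensor_coeff_affine (a := a) (b := b) (δ := δ) (m := m)
    (β := fun p => coordI a b (p + m) (mul (L a b 0) (L a b p))) (fun p q s => ?_)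
  · exact ⟨_, rfl, by simpa using this⟩
  · have e := congrArg (coordI a b (p + q + s + m)) (mul_L_L_shift h p q s)
    simp only [map_smul, map_add, smul_eq_mul, coordI_lie_L, coordI_L_lie] at e
    rw [show p + q + s + m - (q + s) = p + m by ring,
      show p + q + s + m - (p + s) = q + m by ring] at e
    rw [e]
    push_cast
    ring

theorem coordL_mul_L_L_eq_zero (h : IsTransposedPoisson δ mul) (hδ : b ≠ -1 ∨ δ ≠ 1 / 2)
    (i j n : ℤ) : coordL a b n (mul (L a b i) (L a b j)) = 0 := by
  obtain ⟨m, rfl⟩ : ∃ m, n = i + j + m := ⟨n - (i + j), by ring⟩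
  obtain ⟨hm, hm'⟩ := coordL_mul_L_L h m
  rw [mul_L_L h, hm]
  rcases eq_or_ne δ (1 / 2) with rfl | hδ'
  -- Multiplication by `L_{k-m}`, read in shift `k`, always has the same `L`-coefficient; varying
  -- the multiplier thus frees the shift while keeping `u` fixed.
  · refine scalar_action_eq_zero (a := a) (hδ.resolve_right (not_not.mpr rfl))
      (D := fun k j => coordI a b (j + k) (mul (L a b (k - m)) (I a b j))) fun k i j => ?_
    have e := coordI_map_I_eq (h.transposed (L a b (k - m))) k i j
    rw [mul_L_L h, show i + k = (k - m + i) + m by ring, hm] at e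
    rw [e]
  · refine (mul_eq_zero.mp hm').resolve_left fun h0 => hδ' ?_
    linear_combination -h0 / 2

theorem coordI_mul_I_of_ne (h : IsTransposedPoisson δ mul) (hδ : δ ≠ 0) {x : WAlg a b}
    (hx : ∀ j n, coordL a b n (mul x (L a b j)) = 0) {n k : ℤ} (hn : n ≠ k) :
    coordI a b n (mul x (I a b k)) = 0 :=
  coordI_map_I_eq_zero hδ (h.transposed x) hx fun _ => hn

theorem mul_L_I_eq_zero (h : IsTransposedPoisson δ mul) (hδ : δ ≠ 0)
    (hδ' : b ≠ -1 ∨ δ ≠ 1 / 2) (i k : ℤ) : mul (L a b i) (I a b k) = 0 := by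
  have hoff : ∀ i n, n ≠ k → coordI a b n (mul (I a b k) (L a b i)) = 0 := fun i n hn => by
    rw [h.comm]
    exact coordI_mul_I_of_ne h hδ (coordL_mul_L_L_eq_zero h hδ' i) hn
  refine ext_coord (fun n => ?_) fun n => ?_
  · rw [map_zero, coordL_map_I hδ (h.transposed _)]
  · rw [map_zero, h.comm]
    rcases ne_or_eq n k with hn | rfl
    · exact hoff i n hn
    -- The diagonal coefficient escapes `inner_coeff_eq_zero` when `δ = 1`. Writing `L_i` as a
    -- multiple of `[L_{i-q}, L_q]` expresses it through off-diagonal ones.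
    · obtain ⟨q, hq, hq₀, hq₁⟩ : ∃ q : ℤ, i - q - q ≠ 0 ∧ q ≠ 0 ∧ i - q ≠ 0 :=
        ⟨i.natAbs + 1, by omega, by omega, by omega⟩
      have e := congrArg (coordI a b n) (h.transposed (I a b n) (L a b (i - q)) (L a b q))
      rw [lie_L_L, show i - q + q = i by ring] at e
      simp only [map_smul, map_add, smul_eq_mul, coordI_lie_L, coordI_L_lie] at e
      rw [hoff (i - q) (n - q) (by omega), hoff q (n - (i - q)) (by omega)] at e
      simp only [mul_zero, neg_zero, add_zero] at e
      exact (mul_eq_zero.mp e).resolve_left (by exact_mod_cast hq)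

theorem mul_I_I_eq_zero (h : IsTransposedPoisson δ mul) (hδ : δ ≠ 0) (i k : ℤ) :
    mul (I a b i) (I a b k) = 0 := by
  have hL : ∀ i j n, coordL a b n (mul (I a b i) (L a b j)) = 0 := fun i j n => by
    rw [h.comm, coordL_map_I hδ (h.transposed _)]
  have hoff : ∀ i k n, n ≠ k → coordI a b n (mul (I a b i) (I a b k)) = 0 := fun i k n hn =>
    coordI_mul_I_of_ne h hδ (hL i) hn
  refine ext_coord (fun n => ?_) fun n => ?_
  · rw [map_zero, coordL_map_I hδ (h.transposed _)]
  · rw [map_zero]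
    rcases ne_or_eq n k with hn | rfl
    · exact hoff i k n hn
    rcases ne_or_eq n i with hn | rfl
    · rw [h.comm]
      exact hoff n i n hn
    -- By commutativity only the `I_n`-coefficient of `I_n·I_n` is left, so `D` has at most one
    -- nonzero value.
    refine inner_coeff_single_support (a := a) (b := b) (m := 0)
      (D := fun k => coordI a b k (mul (I a b n) (I a b k))) hδ (fun i j => ?_) fun k hk => ?_
    · have e := coordI_map_I_eq (h.transposed (I a b n)) 0 i j
      rw [hL, mul_zero, zero_add] at e
      simpa using e
    · rw [h.comm]
      exact hoff k n k hk

/-- For `b = -1` the constant `L`-coefficient is a particular solution of the equation for `L·I`;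
the difference solves the homogeneous one with `δ = 1/2 ≠ 1`. -/
theorem mul_L_I_of_eq_half {mul : WAlg a (-1) →ₗ[ℂ] WAlg a (-1) →ₗ[ℂ] WAlg a (-1)}
    (h : IsTransposedPoisson (1 / 2) mul) (i k n : ℤ) :
    coordI a (-1) n (mul (L a (-1) i) (I a (-1) k)) =
      coordL a (-1) (n - (i + k)) (mul (L a (-1) 0) (L a (-1) 0)) := by
  have := inner_coeff_eq_zero (a := a) (b := -1) (δ := 1 / 2) (m := n - k)
    (D := fun j => coordI a (-1) (j + (n - k)) (mul (L a (-1) i) (I a (-1) j)) -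
      coordL a (-1) (n - (i + k)) (mul (L a (-1) 0) (L a (-1) 0)))
    (by norm_num) (by norm_num) (fun p j => ?_) k
  · rw [show k + (n - k) = n by ring] at this
    exact sub_eq_zero.mp this
  · have e := coordI_map_I_eq (h.transposed (L a (-1) i)) (n - k) p j
    rw [mul_L_L h, show p + (n - k) = i + p + (n - (i + k)) by ring,
      (coordL_mul_L_L h (n - (i + k))).1] at e
    push_cast at e ⊢
    linear_combination e

/-- For `δ = 0` the product kills all brackets. Every `L_n` is a multiple of a bracket, and so is
`I_n` unless `b = 1` and `a = -n`: this is the source of the exclusion when `b = 1`. -/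
theorem delta_ne_zero (h : IsNontrivialTransposedPoisson δ mul)
    (hb : δ ≠ 0 ∨ b ≠ 1 ∨ ∀ n : ℤ, a ≠ n) : δ ≠ 0 := by
  rintro rfl
  have h0 : ∀ x y z, mul x ⁅y, z⁆ = 0 := fun x y z => by rw [h.transposed, zero_smul]
  have hL : ∀ x n, mul x (L a b n) = 0 := fun x n => by
    obtain ⟨q, hq⟩ : ∃ q : ℤ, q = n.natAbs + 1 := ⟨_, rfl⟩
    have e := h0 x (L a b (n - q)) (L a b q)
    rw [lie_L_L, map_smul, show n - q + q = n by ring] at e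
    have hq' : n - q - q ≠ 0 := by omega
    exact (smul_eq_zero.mp e).resolve_left (by exact_mod_cast hq')
  have hI : ∀ x n, mul x (I a b n) = 0 := fun x n => by
    by_contra hx
    have e0 := h0 x (L a b 0) (I a b n)
    have e1 := h0 x (L a b 1) (I a b (n - 1))
    rw [lie_L_I, map_smul, zero_add] at e0
    rw [lie_L_I, map_smul, show 1 + (n - 1) = n by ring] at e1
    have e0 := (smul_eq_zero.mp e0).resolve_right hx
    have e1 := (smul_eq_zero.mp e1).resolve_right hx
    push_cast at e0 e1
    rcases hb with hb | hb | hb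
    · exact hb rfl
    · exact hb (by linear_combination e0 - e1)
    · exact hb (-n) (by push_cast; linear_combination -e0)
  obtain ⟨x, y, hxy⟩ := h.mul_ne_zero
  exact hxy (LinearMap.congr_fun (linearMap_ext (g := 0) (hL x) (hI x)) y)

theorem exists_mul_L_L_ne_zero (h : IsNontrivialTransposedPoisson δ mul) (hδ : δ ≠ 0)
    (hLI : (∀ i j, mul (L a b i) (L a b j) = 0) → ∀ i j, mul (L a b i) (I a b j) = 0) :
    ∃ n, mul (L a b 0) (L a b n) ≠ 0 := by
  by_contra! hz
  have hLL : ∀ i j, mul (L a b i) (L a b j) = 0 := fun i j => by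
    rw [mul_L_L h.toIsTransposedPoisson, hz]
  obtain ⟨x, y, hxy⟩ := h.mul_ne_zero
  refine hxy (LinearMap.congr_fun₂ (bilin_ext (g := 0) hLL (hLI hLL) (fun i j => ?_)
    (mul_I_I_eq_zero h.toIsTransposedPoisson hδ)) x y)
  rw [h.comm, hLI hLL]
  rfl

end Product

/-! ### Finitely supported coefficient families -/

/-- The `L`-coefficients of an element. -/
def coeffL (x : WAlg a b) : ℤ →₀ ℂ :=
  ((basis a b).repr x).comapDomain Sum.inl Sum.inl_injective.injOn

/-- The `I`-coefficients of an element. -/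
def coeffI (x : WAlg a b) : ℤ →₀ ℂ :=
  ((basis a b).repr x).comapDomain Sum.inr Sum.inr_injective.injOn

theorem coeffL_apply (x : WAlg a b) (n : ℤ) : coeffL x n = coordL a b n x := rfl

theorem coeffI_apply (x : WAlg a b) (n : ℤ) : coeffI x n = coordI a b n x := rfl

/-- The element `∑ k, ν k • L (n + k)`. -/
def seriesL (a b : ℂ) (ν : ℤ →₀ ℂ) (n : ℤ) : WAlg a b := ν.sum fun k c => c • L a b (n + k)

/-- The element `∑ k, (w (n + k) * μ k) • I (n + k)`. -/
def seriesI (a b : ℂ) (w : ℤ → ℂ) (μ : ℤ →₀ ℂ) (n : ℤ) : WAlg a b :=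
  μ.sum fun k c => (w (n + k) * c) • I a b (n + k)

@[simp] theorem coordL_seriesL (ν : ℤ →₀ ℂ) (n N : ℤ) :
    coordL a b N (seriesL a b ν n) = ν (N - n) := by
  rw [seriesL, Finsupp.sum, map_sum, Finset.sum_eq_single (N - n)]
  · simp
  · intro k _ hk
    rw [map_smul, coordL_L, if_neg (by omega), smul_zero]
  · intro hk
    rw [Finsupp.notMem_support_iff.mp hk]
    simp

@[simp] theorem coordI_seriesI (w : ℤ → ℂ) (μ : ℤ →₀ ℂ) (n N : ℤ) :
    coordI a b N (seriesI a b w μ n) = w N * μ (N - n) := by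
  rw [seriesI, Finsupp.sum, map_sum, Finset.sum_eq_single (N - n)]
  · simp
  · intro k _ hk
    rw [map_smul, coordI_I, if_neg (by omega), smul_zero]
  · intro hk
    rw [Finsupp.notMem_support_iff.mp hk]
    simp

@[simp] theorem coordI_seriesL (ν : ℤ →₀ ℂ) (n N : ℤ) :
    coordI a b N (seriesL a b ν n) = 0 := by
  simp [seriesL, map_finsuppSum]

@[simp] theorem coordL_seriesI (w : ℤ → ℂ) (μ : ℤ →₀ ℂ) (n N : ℤ) :
    coordL a b N (seriesI a b w μ n) = 0 := by
  simp [seriesI, map_finsuppSum]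

end WAlg

namespace WAlg

variable {a b : ℂ}

/-! ### Verification of the explicit products -/

theorem basis_induction {p : WAlg a b → Prop} (hL : ∀ i, p (L a b i)) (hI : ∀ i, p (I a b i))
    (hadd : ∀ x y, p x → p y → p (x + y)) (hsmul : ∀ (c : ℂ) x, p x → p (c • x)) (x : WAlg a b) :
    p x := by
  have hx : x ∈ Submodule.span ℂ (Set.range (basis a b)) := by
    rw [(basis a b).span_eq]
    trivial
  induction hx using Submodule.span_induction with
  | mem x hx =>
    obtain ⟨s, rfl⟩ := hx
    exact s.casesOn hL hI
  | zero => simpa using hsmul 0 _ (hL 0)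
  | add x y _ _ hx hy => exact hadd x y hx hy
  | smul c x _ hx => exact hsmul c x hx

/-- The axioms of a transposed `δ`-Poisson structure for a product given on the basis by
`L_i · L_j = F (i + j)`, `L_i · I_j = G (i + j)` and `I_i · I_j = 0`. -/
theorem isTransposedPoisson_of_table {δ : ℂ} {mul : WAlg a b →ₗ[ℂ] WAlg a b →ₗ[ℂ] WAlg a b}
    {F G : ℤ → WAlg a b}
    (hLL : ∀ i j, mul (L a b i) (L a b j) = F (i + j))
    (hLI : ∀ i j, mul (L a b i) (I a b j) = G (i + j))
    (hIL : ∀ i j, mul (I a b i) (L a b j) = G (i + j))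
    (hII : ∀ i j, mul (I a b i) (I a b j) = 0)
    (hFL : ∀ n k, mul (F n) (L a b k) = mul (F (n + k)) (L a b 0))
    (hFI : ∀ n k, mul (F n) (I a b k) = mul (G (n + k)) (L a b 0))
    (hGL : ∀ n k, mul (G n) (L a b k) = mul (G (n + k)) (L a b 0))
    (hGI : ∀ n k, mul (G n) (I a b k) = 0)
    (tLLL : ∀ i j k : ℤ, ((j : ℂ) - k) • F (i + j + k) =
      δ • (⁅F (i + j), L a b k⁆ + ⁅L a b j, F (i + k)⁆))
    (tLLI : ∀ i j k : ℤ, (-((k : ℂ) + b * j + a)) • G (i + j + k) =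
      δ • (⁅F (i + j), I a b k⁆ + ⁅L a b j, G (i + k)⁆))
    (tILL : ∀ i j k : ℤ, ((j : ℂ) - k) • G (i + j + k) =
      δ • (⁅G (i + j), L a b k⁆ + ⁅L a b j, G (i + k)⁆))
    (tGI : ∀ n k, ⁅G n, I a b k⁆ = 0) : IsTransposedPoisson δ mul := by
  have hcomm : ∀ x y, mul x y = mul y x := by
    have : mul = mul.flip := bilin_ext (fun i j => by simp [hLL, add_comm])
      (fun i j => by simp [hLI, hIL, add_comm]) (fun i j => by simp [hLI, hIL, add_comm])
      (fun i j => by simp [hII])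
    exact fun x y => LinearMap.congr_fun₂ this x y
  have tIG : ∀ n k, ⁅I a b k, G n⁆ = 0 := fun n k => by rw [← lie_skew, tGI, neg_zero]
  refine ⟨hcomm, fun x y z => ?_, fun x y z => ?_⟩
  · induction x using basis_induction with
    | hadd x x' hx hx' => simp only [map_add, LinearMap.add_apply, hx, hx']
    | hsmul c x hx => simp only [map_smul, LinearMap.smul_apply, hx]
    | hL i =>
      induction y using basis_induction with
      | hadd x x' hx hx' => simp only [map_add, LinearMap.add_apply, hx, hx']
      | hsmul c x hx => simp only [map_smul, LinearMap.smul_apply, hx]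
      | hL j =>
        induction z using basis_induction with
        | hadd x x' hx hx' => simp only [map_add, hx, hx']
        | hsmul c x hx => simp only [map_smul, hx]
        | hL k =>
          rw [hLL, hLL, hcomm (L a b i), hFL, hFL (j + k), show i + j + k = j + k + i by ring]
        | hI k =>
          rw [hLL, hLI, hcomm (L a b i), hFI, hGL (j + k), show i + j + k = j + k + i by ring]
      | hI j =>
        induction z using basis_induction with
        | hadd x x' hx hx' => simp only [map_add, hx, hx']
        | hsmul c x hx => simp only [map_smul, hx]
        | hL k =>
          rw [hLI, hIL, hcomm (L a b i), hGL, hGL (j + k), show i + j + k = j + k + i by ring]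
        | hI k => rw [hLI, hII, hGI, map_zero]
    | hI i =>
      induction y using basis_induction with
      | hadd x x' hx hx' => simp only [map_add, LinearMap.add_apply, hx, hx']
      | hsmul c x hx => simp only [map_smul, LinearMap.smul_apply, hx]
      | hL j =>
        induction z using basis_induction with
        | hadd x x' hx hx' => simp only [map_add, hx, hx']
        | hsmul c x hx => simp only [map_smul, hx]
        | hL k =>
          rw [hIL, hLL, hcomm (I a b i), hGL, hFI (j + k), show i + j + k = j + k + i by ring]
        | hI k => rw [hIL, hLI, hcomm (I a b i), hGI, hGI]
      | hI j =>
        induction z using basis_induction with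
        | hadd x x' hx hx' => simp only [map_add, hx, hx']
        | hsmul c x hx => simp only [map_smul, hx]
        | hL k => rw [hII, hIL, hcomm (I a b i), hGI, map_zero, LinearMap.zero_apply]
        | hI k => rw [hII, hII, map_zero, map_zero, LinearMap.zero_apply]
  · induction x using basis_induction with
    | hadd x x' hx hx' =>
      simp only [map_add, LinearMap.add_apply, hx, hx', add_lie, lie_add]
      module
    | hsmul c x hx =>
      simp only [map_smul, LinearMap.smul_apply, hx, smul_lie, lie_smul]
      module
    | hL i =>
      induction y using basis_induction with
      | hadd x x' hx hx' =>
        simp only [map_add, hx, hx', add_lie]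
        module
      | hsmul c x hx =>
        simp only [map_smul, hx, smul_lie]
        module
      | hL j =>
        induction z using basis_induction with
        | hadd x x' hx hx' =>
          simp only [map_add, hx, hx', lie_add]
          module
        | hsmul c x hx =>
          simp only [map_smul, hx, lie_smul]
          module
        | hL k => rw [hLL, hLL, lie_L_L, map_smul, hLL, ← tLLL, add_assoc i j k]
        | hI k => rw [hLL, hLI, lie_L_I, map_smul, hLI, ← tLLI, add_assoc i j k]
      | hI j =>
        induction z using basis_induction with
        | hadd x x' hx hx' =>
          simp only [map_add, hx, hx', lie_add]
          module
        | hsmul c x hx =>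
          simp only [map_smul, hx, lie_smul]
          module
        | hL k =>
          rw [hLI, hLL, lie_I_L, map_smul, hLI, ← lie_skew (G (i + j)), ← lie_skew (I a b j),
            ← neg_add, smul_neg, add_comm ⁅L a b k, _⁆, ← tLLI, ← neg_smul, neg_neg,
            show i + k + j = i + (j + k) by ring]
        | hI k => rw [hLI, hLI, lie_I_I, map_zero, tGI, tIG, add_zero, smul_zero]
    | hI i =>
      induction y using basis_induction with
      | hadd x x' hx hx' =>
        simp only [map_add, hx, hx', add_lie]
        module
      | hsmul c x hx =>
        simp only [map_smul, hx, smul_lie]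
        module
      | hL j =>
        induction z using basis_induction with
        | hadd x x' hx hx' =>
          simp only [map_add, hx, hx', lie_add]
          module
        | hsmul c x hx =>
          simp only [map_smul, hx, lie_smul]
          module
        | hL k => rw [hIL, hIL, lie_L_L, map_smul, hIL, ← tILL, add_assoc i j k]
        | hI k => rw [hIL, hII, lie_L_I, map_smul, hII, tGI, lie_zero, smul_zero, add_zero, smul_zero]
      | hI j =>
        induction z using basis_induction with
        | hadd x x' hx hx' =>
          simp only [map_add, hx, hx', lie_add]
          module
        | hsmul c x hx =>
          simp only [map_smul, hx, lie_smul]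
          module
        | hL k => rw [hII, hIL, lie_I_L, map_smul, hII, tIG, zero_lie, smul_zero, add_zero, smul_zero]
        | hI k => rw [hII, hII, lie_I_I, map_zero, zero_lie, lie_zero, add_zero, smul_zero]

/-- The condition `hδ` is the transposed law on three `L`'s read at `I_N`. When `ν = 0` all triple
products vanish, so associativity constrains neither `w` nor `μ`. -/
theorem isNontrivialTransposedPoisson_of_series {δ : ℂ}
    {mul : WAlg a b →ₗ[ℂ] WAlg a b →ₗ[ℂ] WAlg a b} {ν μ : ℤ →₀ ℂ} {w : ℤ → ℂ}
    (hw : ∃ N, w N ≠ 0) (hne : ν ≠ 0 ∨ μ ≠ 0)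
    (hδ : ∀ N j k : ℤ, ((j : ℂ) - k) * w N =
      δ * (((N : ℂ) - k + b * k + a) * w (N - k) - ((N : ℂ) - j + b * j + a) * w (N - j)))
    (hν : ν = 0 ∨ b = -1 ∧ δ = 1 / 2 ∧ w = 1)
    (hLL : ∀ i j, mul (L a b i) (L a b j) = seriesL a b ν (i + j) + seriesI a b w μ (i + j))
    (hLI : ∀ i j, mul (L a b i) (I a b j) = seriesI a b 1 ν (i + j))
    (hIL : ∀ i j, mul (I a b i) (L a b j) = seriesI a b 1 ν (i + j))
    (hII : ∀ i j, mul (I a b i) (I a b j) = 0) : IsNontrivialTransposedPoisson δ mul := by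
  have hsub : ∀ N i j k : ℤ, N - k - (i + j) = N - (i + j + k) := fun N i j k => by ring
  have hIser : ∀ (w : ℤ → ℂ) (μ : ℤ →₀ ℂ) n k,
      mul (seriesI a b w μ n) (I a b k) = 0 := fun w μ n k => by
    simp [seriesI, Finsupp.sum, map_sum, LinearMap.sum_apply, hII]
  refine ⟨isTransposedPoisson_of_table
    (F := fun n => seriesL a b ν n + seriesI a b w μ n) (G := seriesI a b 1 ν) hLL hLI hIL hII
    ?_ ?_ ?_ (hIser _ _) ?_ ?_ ?_ ?_, ?_, ?_⟩
  · intro n k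
    rcases hν with rfl | ⟨-, -, rfl⟩
    · simp [seriesL, seriesI, Finsupp.sum, map_sum, LinearMap.sum_apply, hIL]
    · simp only [seriesL, seriesI, Finsupp.sum, map_sum, map_add, map_smul, LinearMap.sum_apply,
        LinearMap.add_apply, LinearMap.smul_apply, hIL, hLL, Pi.one_apply, add_right_comm n _ k,
        add_zero]
  · intro n k
    rcases hν with rfl | ⟨-, -, rfl⟩
    · simp [seriesL, seriesI, Finsupp.sum, map_sum, LinearMap.sum_apply, hII]
    · rw [map_add, LinearMap.add_apply, hIser, add_zero]
      simp only [seriesL, seriesI, Finsupp.sum, map_sum, map_smul, LinearMap.sum_apply,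
        LinearMap.smul_apply, hIL, hLI, Pi.one_apply, add_right_comm n _ k, add_zero, one_mul]
  · intro n k
    simp only [seriesI, Finsupp.sum, map_sum, map_smul, LinearMap.sum_apply,
      LinearMap.smul_apply, hIL, Pi.one_apply, add_right_comm n _ k, add_zero]
  · intro i j k
    refine ext_coord (fun N => ?_) fun N => ?_
    · simp only [map_add, map_smul, smul_eq_mul, coordL_lie_L, coordL_L_lie, coordL_seriesL,
        coordL_seriesI, add_zero, hsub, add_right_comm i k j]
      rcases hν with rfl | ⟨-, rfl, -⟩
      · simp
      · ring
    · simp only [map_add, map_smul, smul_eq_mul, coordI_lie_L, coordI_L_lie, coordI_seriesL,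
        coordI_seriesI, zero_add, hsub, add_right_comm i k j]
      linear_combination μ (N - (i + j + k)) * hδ N j k
  · intro i j k
    refine ext_coord (fun N => ?_) fun N => ?_
    · simp only [map_add, map_smul, smul_eq_mul, coordL_lie_I, coordL_L_lie, coordL_seriesI]
      ring
    · simp only [map_add, map_smul, smul_eq_mul, coordI_lie_I, coordI_L_lie, coordI_seriesI,
        coordL_seriesI, coordL_seriesL, add_zero, hsub, add_right_comm i k j, Pi.one_apply]
      rcases hν with rfl | ⟨rfl, rfl, -⟩
      · simp
      · ring
  · intro i j k
    refine ext_coord (fun N => ?_) fun N => ?_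
    · simp only [map_add, map_smul, smul_eq_mul, coordL_lie_L, coordL_L_lie, coordL_seriesI]
      ring
    · simp only [map_add, map_smul, smul_eq_mul, coordI_lie_L, coordI_L_lie, coordI_seriesI,
        hsub, add_right_comm i k j, Pi.one_apply]
      rcases hν with rfl | ⟨rfl, rfl, -⟩
      · simp
      · ring
  · intro n k
    refine ext_coord (fun N => ?_) fun N => ?_
    · rw [coordL_lie_I, map_zero]
    · rw [coordI_lie_I, coordL_seriesI, mul_zero, map_zero]
  · by_contra! h0
    have hz := fun n => (hLL 0 n).symm.trans (h0 _ _)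
    simp only [zero_add] at hz
    rcases hne with hne | hne
    · refine hne (Finsupp.ext fun k => ?_)
      simpa using congrArg (coordL a b k) (hz 0)
    · refine hne (Finsupp.ext fun k => ?_)
      -- The coefficient of `I_N` in `L_0·L_{N-k}` is `w N * μ k`, so an index with nonzero weight
      -- recovers `μ k`.
      obtain ⟨N, hN⟩ := hw
      simpa [hN] using congrArg (coordI a b N) (hz (N - k))
  · refine ⟨L a b 1, L a b 0, fun h => ?_⟩
    simpa using (congrArg (coordL a b 1) h).symm.trans (congrArg (coordL a b 1) (lie_L_L 1 0))

/-- The multiplication table of the product attached to `ν`, `μ` and the weight `w`. -/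
def seriesTable (a b : ℂ) (w : ℤ → ℂ) (ν μ : ℤ →₀ ℂ) : ℤ ⊕ ℤ → ℤ ⊕ ℤ → WAlg a b
  | Sum.inl i, Sum.inl j => seriesL a b ν (i + j) + seriesI a b w μ (i + j)
  | Sum.inl i, Sum.inr j => seriesI a b 1 ν (i + j)
  | Sum.inr i, Sum.inl j => seriesI a b 1 ν (i + j)
  | Sum.inr _, Sum.inr _ => 0

theorem exists_mul_eq_seriesTable (a b : ℂ) (w : ℤ → ℂ) (ν μ : ℤ →₀ ℂ) :
    ∃ mul : WAlg a b →ₗ[ℂ] WAlg a b →ₗ[ℂ] WAlg a b,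
      ∀ s t, mul (basis a b s) (basis a b t) = seriesTable a b w ν μ s t :=
  ⟨(basis a b).constr ℂ fun s => (basis a b).constr ℂ (seriesTable a b w ν μ s), fun s t => by
    simp [Module.Basis.constr_basis]⟩

theorem exists_isNontrivialTransposedPoisson {δ : ℂ} {w : ℤ → ℂ} (hw : ∃ N, w N ≠ 0)
    (hδ : ∀ N j k : ℤ, ((j : ℂ) - k) * w N =
      δ * (((N : ℂ) - k + b * k + a) * w (N - k) - ((N : ℂ) - j + b * j + a) * w (N - j))) :
    ∃ mul : WAlg a b →ₗ[ℂ] WAlg a b →ₗ[ℂ] WAlg a b, IsNontrivialTransposedPoisson δ mul := by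
  obtain ⟨mul, h⟩ := exists_mul_eq_seriesTable a b w 0 (Finsupp.single 0 1)
  exact ⟨mul, isNontrivialTransposedPoisson_of_series hw (Or.inr (by simp)) hδ (Or.inl rfl)
    (fun i j => h (Sum.inl i) (Sum.inl j)) (fun i j => h (Sum.inl i) (Sum.inr j))
    (fun i j => h (Sum.inr i) (Sum.inl j)) fun i j => h (Sum.inr i) (Sum.inr j)⟩

end WAlg

namespace WAlg

variable {a b δ : ℂ} {mul : WAlg a b →ₗ[ℂ] WAlg a b →ₗ[ℂ] WAlg a b}

/-! ### Normal forms -/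

theorem seriesL_zero (n : ℤ) : seriesL a b 0 n = 0 := by simp [seriesL]

theorem seriesI_zero (w : ℤ → ℂ) (n : ℤ) : seriesI a b w 0 n = 0 := by simp [seriesI]

theorem seriesI_one (μ : ℤ →₀ ℂ) (n : ℤ) :
    seriesI a b 1 μ n = μ.sum fun k c => c • I a b (n + k) := by simp [seriesI]

/-- A nonzero slope would need `δ = 1` and `δ b = 1`, hence `b = 1`. -/
theorem coordI_mul_L_L_const (h : IsTransposedPoisson δ mul) (hb : b ≠ 1) (m : ℤ) :
    (∀ p, coordI a b (p + m) (mul (L a b 0) (L a b p)) =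
      coordI a b m (mul (L a b 0) (L a b 0))) ∧
    (1 - δ * (1 - b)) * coordI a b m (mul (L a b 0) (L a b 0)) = 0 := by
  obtain ⟨v, -, hp, h1, h2, hu⟩ := coordI_mul_L_L h m
  have hv : v = 0 := by
    by_contra hv
    have h1 := (mul_eq_zero.mp h1).resolve_right hv
    have h2 := (mul_eq_zero.mp h2).resolve_right hv
    exact hb (by linear_combination b * h1 - h2)
  subst hv
  exact ⟨fun p => by rw [hp, zero_mul, add_zero], by linear_combination hu⟩

theorem coordI_mul_L_L_linear {mul : WAlg a 1 →ₗ[ℂ] WAlg a 1 →ₗ[ℂ] WAlg a 1}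
    (h : IsTransposedPoisson δ mul) (m : ℤ) :
    ∃ v : ℂ, v = coordI a 1 (1 + m) (mul (L a 1 0) (L a 1 1)) -
        coordI a 1 m (mul (L a 1 0) (L a 1 0)) ∧
      (∀ p : ℤ, coordI a 1 (p + m) (mul (L a 1 0) (L a 1 p)) = ((p : ℂ) + m + a) * v) ∧
      (1 - δ) * v = 0 := by
  obtain ⟨v, hv, hp, h1, -, hu⟩ := coordI_mul_L_L h m
  refine ⟨v, hv, fun p => ?_, h1⟩
  rw [hp]
  linear_combination hu - ((m : ℂ) + a) * h1

theorem delta_eq_of_ne (h : IsNontrivialTransposedPoisson δ mul) (hb : b ≠ -1) (hb' : b ≠ 1) :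
    δ = 1 / (1 - b) ∧ ∃ μ : ℤ →₀ ℂ, μ ≠ 0 ∧
      (∀ i j, mul (L a b i) (L a b j) = seriesI a b 1 μ (i + j)) ∧
      (∀ i j, mul (L a b i) (I a b j) = 0) ∧ ∀ i j, mul (I a b i) (I a b j) = 0 := by
  have hT := h.toIsTransposedPoisson
  have hδ := delta_ne_zero h (Or.inr (Or.inl hb'))
  have hLI := mul_L_I_eq_zero hT hδ (Or.inl hb)
  have hLL : ∀ i j, mul (L a b i) (L a b j) =
      seriesI a b 1 (coeffI (mul (L a b 0) (L a b 0))) (i + j) := by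
    intro i j
    refine ext_coord (fun N => ?_) fun N => ?_
    · rw [coordL_mul_L_L_eq_zero hT (Or.inl hb), coordL_seriesI]
    · have := (coordI_mul_L_L_const hT hb' (N - (i + j))).1 (i + j)
      rw [add_sub_cancel] at this
      rw [mul_L_L hT, this, coordI_seriesI, Pi.one_apply, one_mul, coeffI_apply]
  have hμ : coeffI (mul (L a b 0) (L a b 0)) ≠ 0 := by
    intro h0
    obtain ⟨n, hn⟩ := exists_mul_L_L_ne_zero h hδ fun _ => hLI
    exact hn (by rw [hLL, h0, seriesI_zero])
  refine ⟨?_, _, hμ, hLL, hLI, mul_I_I_eq_zero hT hδ⟩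
  obtain ⟨m, hm⟩ := Finsupp.ne_iff.mp hμ
  have h1 := (mul_eq_zero.mp (coordI_mul_L_L_const hT hb' m).2).resolve_right hm
  rw [eq_div_iff (sub_ne_zero.mpr hb'.symm)]
  linear_combination -h1

theorem delta_eq_of_eq_one {mul : WAlg a 1 →ₗ[ℂ] WAlg a 1 →ₗ[ℂ] WAlg a 1}
    (h : IsNontrivialTransposedPoisson δ mul) (hδ : δ ≠ 0) :
    δ = 1 ∧ ∃ μ : ℤ →₀ ℂ, μ ≠ 0 ∧
      (∀ i j, mul (L a 1 i) (L a 1 j) = seriesI a 1 (fun N => N + a) μ (i + j)) ∧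
      (∀ i j, mul (L a 1 i) (I a 1 j) = 0) ∧ ∀ i j, mul (I a 1 i) (I a 1 j) = 0 := by
  have hT := h.toIsTransposedPoisson
  have hb : (1 : ℂ) ≠ -1 ∨ δ ≠ 1 / 2 := Or.inl (by norm_num)
  have hLI := mul_L_I_eq_zero hT hδ hb
  -- The parameter `μ m` is the slope in shift `m`; as a difference of coefficients of two fixed
  -- elements it is finitely supported.
  obtain ⟨μ, hμ⟩ : ∃ μ : ℤ →₀ ℂ, ∀ m, μ m = coordI a 1 (1 + m) (mul (L a 1 0) (L a 1 1)) -
      coordI a 1 m (mul (L a 1 0) (L a 1 0)) :=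
    ⟨(coeffI (mul (L a 1 0) (L a 1 1))).comapDomain (1 + ·) (add_right_injective 1).injOn -
      coeffI (mul (L a 1 0) (L a 1 0)), fun m => rfl⟩
  have hLL : ∀ i j, mul (L a 1 i) (L a 1 j) = seriesI a 1 (fun N => N + a) μ (i + j) := by
    intro i j
    refine ext_coord (fun N => ?_) fun N => ?_
    · rw [coordL_mul_L_L_eq_zero hT hb, coordL_seriesI]
    · obtain ⟨v, hv, hp, -⟩ := coordI_mul_L_L_linear hT (N - (i + j))
      have := hp (i + j)
      rw [add_sub_cancel] at this
      rw [mul_L_L hT, this, coordI_seriesI, hμ, ← hv]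
      push_cast
      ring
  have hμ0 : μ ≠ 0 := by
    intro h0
    obtain ⟨n, hn⟩ := exists_mul_L_L_ne_zero h hδ fun _ => hLI
    exact hn (by rw [hLL, h0, seriesI_zero])
  refine ⟨?_, _, hμ0, hLL, hLI, mul_I_I_eq_zero hT hδ⟩
  obtain ⟨m, hm⟩ := Finsupp.ne_iff.mp hμ0
  obtain ⟨v, hv, -, h1⟩ := coordI_mul_L_L_linear hT m
  rw [hμ, ← hv] at hm
  linear_combination -(mul_eq_zero.mp h1).resolve_right hm

theorem delta_eq_of_eq_neg_one {mul : WAlg a (-1) →ₗ[ℂ] WAlg a (-1) →ₗ[ℂ] WAlg a (-1)}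
    (h : IsNontrivialTransposedPoisson δ mul) :
    δ = 1 / 2 ∧ ∃ ν μ : ℤ →₀ ℂ, (ν ≠ 0 ∨ μ ≠ 0) ∧
      (∀ i j, mul (L a (-1) i) (L a (-1) j) =
        seriesL a (-1) ν (i + j) + seriesI a (-1) 1 μ (i + j)) ∧
      (∀ i j, mul (L a (-1) i) (I a (-1) j) = seriesI a (-1) 1 ν (i + j)) ∧
      ∀ i j, mul (I a (-1) i) (I a (-1) j) = 0 := by
  have hT := h.toIsTransposedPoisson
  have hb : (-1 : ℂ) ≠ 1 := by norm_num
  have hδ := delta_ne_zero h (Or.inr (Or.inl hb))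
  have hLL : ∀ i j, mul (L a (-1) i) (L a (-1) j) =
      seriesL a (-1) (coeffL (mul (L a (-1) 0) (L a (-1) 0))) (i + j) +
        seriesI a (-1) 1 (coeffI (mul (L a (-1) 0) (L a (-1) 0))) (i + j) := by
    intro i j
    refine ext_coord (fun N => ?_) fun N => ?_
    · have := (coordL_mul_L_L hT (N - (i + j))).1 (i + j)
      rw [add_sub_cancel] at this
      rw [mul_L_L hT, this, map_add, coordL_seriesI, coordL_seriesL, add_zero, coeffL_apply]
    · have := (coordI_mul_L_L_const hT hb (N - (i + j))).1 (i + j)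
      rw [add_sub_cancel] at this
      rw [mul_L_L hT, this, map_add, coordI_seriesL, coordI_seriesI, zero_add, Pi.one_apply,
        one_mul, coeffI_apply]
  -- For `b = -1` the `L`- and the `I`-coefficients carry the same factor `1 - 2δ`, so otherwise the
  -- whole product vanishes.
  have hδ2 : δ = 1 / 2 := by
    by_contra hδ2
    obtain ⟨n, hn⟩ := exists_mul_L_L_ne_zero h hδ fun _ => mul_L_I_eq_zero hT hδ (Or.inr hδ2)
    have h2 : 1 - 2 * δ ≠ 0 := fun h0 => hδ2 (by linear_combination -h0 / 2)
    refine hn (ext_coord (fun N => ?_) fun N => ?_)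
    · rw [coordL_mul_L_L_eq_zero hT (Or.inr hδ2), map_zero]
    · obtain ⟨hp, hu⟩ := coordI_mul_L_L_const hT hb (N - n)
      have := hp n
      rw [add_sub_cancel] at this
      rw [this, map_zero]
      exact (mul_eq_zero.mp hu).resolve_left fun h0 => h2 (by linear_combination h0)
  subst hδ2
  have hLI : ∀ i j, mul (L a (-1) i) (I a (-1) j) =
      seriesI a (-1) 1 (coeffL (mul (L a (-1) 0) (L a (-1) 0))) (i + j) := by
    intro i j
    refine ext_coord (fun N => ?_) fun N => ?_
    · rw [coordL_map_I hδ (hT.transposed _), coordL_seriesI]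
    · rw [mul_L_I_of_eq_half hT, coordI_seriesI, Pi.one_apply, one_mul, coeffL_apply]
  refine ⟨rfl, _, _, ?_, hLL, hLI, mul_I_I_eq_zero hT hδ⟩
  by_contra! h0
  obtain ⟨n, hn⟩ := exists_mul_L_L_ne_zero h hδ fun _ i j => by rw [hLI, h0.1, seriesI_zero]
  exact hn (by rw [hLL, h0.1, h0.2, seriesL_zero, seriesI_zero, add_zero])

end WAlg

end

/-! ### The classification in the three cases. -/

theorem mainTheorem5 (a b : ℂ) :
    ((b ≠ -1 ∧ b ≠ 1) →
      (∃ mul : WAlg a b →ₗ[ℂ] WAlg a b →ₗ[ℂ] WAlg a b,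
        IsNontrivialTransposedPoisson (1 / (1 - b)) mul) ∧
      ∀ (δ : ℂ) (mul : WAlg a b →ₗ[ℂ] WAlg a b →ₗ[ℂ] WAlg a b),
        IsNontrivialTransposedPoisson δ mul ↔
          δ = 1 / (1 - b) ∧ ∃ μ : ℤ →₀ ℂ, μ ≠ 0 ∧ ∀ i j : ℤ,
            mul (WAlg.L a b i) (WAlg.L a b j) =
              μ.sum (fun k c => c • WAlg.I a b (i + j + k)) ∧
            mul (WAlg.L a b i) (WAlg.I a b j) = 0 ∧
            mul (WAlg.I a b i) (WAlg.L a b j) = 0 ∧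
            mul (WAlg.I a b i) (WAlg.I a b j) = 0) ∧
    (b = 1 →
      (∃ mul : WAlg a b →ₗ[ℂ] WAlg a b →ₗ[ℂ] WAlg a b,
        IsNontrivialTransposedPoisson 1 mul) ∧
      ∀ (δ : ℂ) (mul : WAlg a b →ₗ[ℂ] WAlg a b →ₗ[ℂ] WAlg a b),
        (δ ≠ 0 ∨ ∀ n : ℤ, a ≠ (n : ℂ)) →
        (IsNontrivialTransposedPoisson δ mul ↔
          δ = 1 ∧ ∃ μ : ℤ →₀ ℂ, μ ≠ 0 ∧ ∀ i j : ℤ,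
            mul (WAlg.L a b i) (WAlg.L a b j) =
              μ.sum (fun k c => (((i : ℂ) + j + k + a) * c) • WAlg.I a b (i + j + k)) ∧
            mul (WAlg.L a b i) (WAlg.I a b j) = 0 ∧
            mul (WAlg.I a b i) (WAlg.L a b j) = 0 ∧
            mul (WAlg.I a b i) (WAlg.I a b j) = 0)) ∧
    (b = -1 →
      (∃ mul : WAlg a b →ₗ[ℂ] WAlg a b →ₗ[ℂ] WAlg a b,
        IsNontrivialTransposedPoisson (1 / 2) mul) ∧
      ∀ (δ : ℂ) (mul : WAlg a b →ₗ[ℂ] WAlg a b →ₗ[ℂ] WAlg a b),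
        IsNontrivialTransposedPoisson δ mul ↔
          δ = 1 / 2 ∧ ∃ ν μ : ℤ →₀ ℂ, (ν ≠ 0 ∨ μ ≠ 0) ∧ ∀ i j : ℤ,
            mul (WAlg.L a b i) (WAlg.L a b j) =
              ν.sum (fun k c => c • WAlg.L a b (i + j + k)) +
                μ.sum (fun k c => c • WAlg.I a b (i + j + k)) ∧
            mul (WAlg.L a b i) (WAlg.I a b j) =
              ν.sum (fun k c => c • WAlg.I a b (i + j + k)) ∧
            mul (WAlg.I a b i) (WAlg.L a b j) =
              ν.sum (fun k c => c • WAlg.I a b (i + j + k)) ∧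
            mul (WAlg.I a b i) (WAlg.I a b j) = 0) := by
  have hwt : ∃ N : ℤ, (fun N : ℤ => (N : ℂ) + a) N ≠ 0 := by
    by_contra! h
    have h0 := h 0
    have h1 := h 1
    push_cast at h0 h1
    exact one_ne_zero (α := ℂ) (by linear_combination h1 - h0)
  refine ⟨fun ⟨hb, hb'⟩ => ?_, ?_, ?_⟩
  · have h1b : 1 - b ≠ 0 := sub_ne_zero.mpr hb'.symm
    have hδ : ∀ N j k : ℤ, ((j : ℂ) - k) * (1 : ℤ → ℂ) N = 1 / (1 - b) *
        (((N : ℂ) - k + b * k + a) * (1 : ℤ → ℂ) (N - k) -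
          ((N : ℂ) - j + b * j + a) * (1 : ℤ → ℂ) (N - j)) := fun N j k => by
      simp only [Pi.one_apply]
      field_simp
      ring
    refine ⟨WAlg.exists_isNontrivialTransposedPoisson ⟨0, one_ne_zero⟩ hδ,
      fun δ mul => ⟨fun h => ?_, ?_⟩⟩
    · obtain ⟨h1, μ, hμ, hLL, hLI, hII⟩ := WAlg.delta_eq_of_ne h hb hb'
      exact ⟨h1, μ, hμ, fun i j => ⟨by rw [hLL, WAlg.seriesI_one], hLI i j,
        by rw [h.comm, hLI], hII i j⟩⟩
    · rintro ⟨rfl, μ, hμ, h⟩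
      refine WAlg.isNontrivialTransposedPoisson_of_series (w := 1) ⟨0, one_ne_zero⟩ (Or.inr hμ) hδ
        (Or.inl rfl) (fun i j => ?_) (fun i j => ?_) (fun i j => ?_) fun i j => (h i j).2.2.2
      · rw [(h i j).1, WAlg.seriesL_zero, WAlg.seriesI_one, zero_add]
      · rw [(h i j).2.1, WAlg.seriesI_zero]
      · rw [(h i j).2.2.1, WAlg.seriesI_zero]
  · rintro rfl
    have hδ : ∀ N j k : ℤ, ((j : ℂ) - k) * ((N : ℂ) + a) = 1 *
        (((N : ℂ) - k + 1 * k + a) * (((N - k : ℤ) : ℂ) + a) -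
          ((N : ℂ) - j + 1 * j + a) * (((N - j : ℤ) : ℂ) + a)) := fun N j k => by
      push_cast
      ring
    have hser : ∀ (μ : ℤ →₀ ℂ) (i j : ℤ), WAlg.seriesI a 1 (fun N => N + a) μ (i + j) =
        μ.sum fun k c => (((i : ℂ) + j + k + a) * c) • WAlg.I a 1 (i + j + k) := fun μ i j => by
      simp only [WAlg.seriesI, Int.cast_add]
    refine ⟨WAlg.exists_isNontrivialTransposedPoisson hwt hδ,
      fun δ mul hδa => ⟨fun h => ?_, ?_⟩⟩
    · obtain ⟨h1, μ, hμ, hLL, hLI, hII⟩ := WAlg.delta_eq_of_eq_one h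
        (WAlg.delta_ne_zero h (hδa.imp_right Or.inr))
      exact ⟨h1, μ, hμ, fun i j => ⟨by rw [hLL, hser], hLI i j,
        by rw [h.comm, hLI], hII i j⟩⟩
    · rintro ⟨rfl, μ, hμ, h⟩
      refine WAlg.isNontrivialTransposedPoisson_of_series hwt (Or.inr hμ) hδ
        (Or.inl rfl) (fun i j => ?_) (fun i j => ?_) (fun i j => ?_) fun i j => (h i j).2.2.2
      · rw [(h i j).1, WAlg.seriesL_zero, hser, zero_add]
      · rw [(h i j).2.1, WAlg.seriesI_zero]
      · rw [(h i j).2.2.1, WAlg.seriesI_zero]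
  · rintro rfl
    have hδ : ∀ N j k : ℤ, ((j : ℂ) - k) * (1 : ℤ → ℂ) N = 1 / 2 *
        (((N : ℂ) - k + -1 * k + a) * (1 : ℤ → ℂ) (N - k) -
          ((N : ℂ) - j + -1 * j + a) * (1 : ℤ → ℂ) (N - j)) := fun N j k => by
      simp only [Pi.one_apply]
      ring
    refine ⟨WAlg.exists_isNontrivialTransposedPoisson ⟨0, one_ne_zero⟩ hδ,
      fun δ mul => ⟨fun h => ?_, ?_⟩⟩
    · obtain ⟨h1, ν, μ, hne, hLL, hLI, hII⟩ := WAlg.delta_eq_of_eq_neg_one h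
      refine ⟨h1, ν, μ, hne, fun i j => ⟨?_, ?_, ?_, hII i j⟩⟩
      · rw [hLL, WAlg.seriesI_one, WAlg.seriesL]
      · rw [hLI, WAlg.seriesI_one]
      · rw [h.comm, hLI, WAlg.seriesI_one, add_comm j i]
    · rintro ⟨rfl, ν, μ, hne, h⟩
      refine WAlg.isNontrivialTransposedPoisson_of_series (w := 1) ⟨0, one_ne_zero⟩ hne hδ
        (Or.inr ⟨rfl, rfl, rfl⟩) (fun i j => ?_) (fun i j => ?_) (fun i j => ?_)
        fun i j => (h i j).2.2.2
      · rw [(h i j).1, WAlg.seriesL, WAlg.seriesI_one]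
      · rw [(h i j).2.1, WAlg.seriesI_one]
      · rw [(h i j).2.2.1, WAlg.seriesI_one]
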